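/- Let $K$ be a field of characteristic $0$ (for example $\mathbb R$ or $\mathbb C$) and let $\mathfrak A$ be an associative $K$-algebra with unit $1$. For a $k$-tuple of elements $\mathcal A_1,\dots,\mathcal A_k\in\mathfrak A$, $k\ge 0$, write $$\mathrm{Sym}_k(\mathcal A_1,\dots,\mathcal A_k)=\frac1{k!}\sum_{\pi\in\Pi_k}\mathcal A_{\pi(1)}\mathcal A_{\pi(2)}\cdots\mathcal A_{\pi(k)},$$ where $\Pi_k$ is the set of all permutations of $\{1,\dots,k\}$; in particular $\mathrm{Sym}_0=1$. For $0\le h\le m$ let $P_{h,m}$ be the set of all subsets of $N_m=\{1,\dots,m\}$ with exactly $h$ elements. Let $l,m\ge 0$, let $\mathcal L_1,\dots,\mathcal L_l$ and $\mathcal M_1,\dots,\mathcal M_m$ be elements of $\mathfrak A$, and let $d_{ij}\in K$ be scalars such that $[\mathcal L_i,\mathcal M_j]=\mathcal L_i\mathcal M_j-\mathcal M_j\mathcal L_i=d_{ij}\,1$ for all $i\in N_l$ and $j\in N_m$. No assumption is made on the commutators $[\mathcal L_i,\mathcal L_j]$ and $[\mathcal M_i,\mathcal M_j]$. Then $$\mathrm{Sym}_l(\mathcal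 L_1,\dots,\mathcal L_l)\,\mathrm{Sym}_m(\mathcal M_1,\dots,\mathcal M_m)=\sum_{h=0}^{\min(l,m)}\ \sum_{I\in P_{h,l}}\ \sum_{J\in P_{h,m}}\ \sum_{\pi\in\Pi_h}\frac1{2^h}\,d_{i_1j_{\pi(1)}}\cdots d_{i_hj_{\pi(h)}}\ \mathrm{Sym}_{l+m-2h}\big(\mathcal L_{i'_1},\dots,\mathcal L_{i'_{l-h}},\mathcal M_{j'_1},\dots,\mathcal M_{j'_{m-h}}\big),$$ where $I=\{i_1<\dots<i_h\}$, $J=\{j_1<\dots<j_h\}$, $N_l\setminus I=\{i'_1<\dots<i'_{l-h}\}$ and $N_m\setminus J=\{j'_1<\dots<j'_{m-h}\}$. -/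

import Mathlib

/-- The symmetrized product `Sym_k(a_1, …, a_k) = (1/k!) ∑_π a_{π(1)} ⋯ a_{π(k)}` of a `k`-tuple of
elements of an associative algebra; the factors of each summand are multiplied from left to right.
For `k = 0` this is the unit of the algebra. -/
noncomputable def symProd (K : Type*) {A : Type*} [Field K] [Ring A] [Algebra K A]
    {k : ℕ} (a : Fin k → A) : A :=
  ((Nat.factorial k : K)⁻¹) •
    ∑ π : Equiv.Perm (Fin k), (List.ofFn (fun r : Fin k => a (π r))).prod

/-- `P_{h,m}`: the set of the parts of an `m`-element index set with exactly `h` elements. -/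
abbrev Parts (h m : ℕ) : Type := {I : Finset (Fin m) // I.card = h}

namespace Parts

/-- The increasing enumeration `i_1 < ⋯ < i_h` of a part `I`. -/
def enum {h m : ℕ} (I : Parts h m) : Fin h ↪o Fin m :=
  I.1.orderEmbOfFin I.2

theorem card_compl {h m : ℕ} (I : Parts h m) : (I.1)ᶜ.card = m - h := by
  rw [Finset.card_compl, Fintype.card_fin, I.2]

/-- The increasing enumeration `i'_1 < ⋯ < i'_{m-h}` of the complement of a part `I`. -/
def enumCompl {h m : ℕ} (I : Parts h m) : Fin (m - h) ↪o Fin m :=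
  (I.1)ᶜ.orderEmbOfFin I.card_compl

end Parts

/-! Index symmetrized products by finite sets instead of tuples. Splitting off the first factor
gives |s| Sym(s) = ∑ a_i Sym(s \ i). The right-hand side of the theorem is a sum over partial
matchings p between the index sets s of the L_i and t of the M_j, with weight 2^(-|p|) ∏ d_ij and
the symmetrized product of the unmatched factors. Both sides F(s, t) satisfy (|s| + |t|) F(s, t) = ∑
L_i F(s \ i, t) + ∑ M_j F(s, t \ j) + ∑ d_ij F(s \ i, t \ j) (`card_smul_finsetSym_mul_finsetSym`,
`card_smul_contractionSum`). In characteristic 0 this recursion determines F from F(∅, ∅) = 1. -/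

/-- The symmetrized product of the elements `a i`, `i ∈ s`, defined through the recursion on the
first factor; only the value at `n = s.card` is meaningful. -/
noncomputable def symAux (K : Type*) {A ι : Type*} [Field K] [Ring A] [Algebra K A] [DecidableEq ι]
    (a : ι → A) : ℕ → Finset ι → A
  | 0, _ => 1
  | n + 1, s => ((n + 1 : ℕ) : K)⁻¹ • ∑ i ∈ s, a i * symAux K a n (s.erase i)

/-- The symmetrized product of the elements `a i`, `i ∈ s`. -/
noncomputable def finsetSym (K : Type*) {A ι : Type*} [Field K] [Ring A] [Algebra K A]
    [DecidableEq ι] (a : ι → A) (s : Finset ι) : A :=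
  symAux K a s.card s

/-! ### Symmetrized products over finite sets -/

section SymmetrizedProduct

variable {K A ι : Type*} [Field K] [Ring A] [Algebra K A] [DecidableEq ι]

theorem finsetSym_empty (a : ι → A) : finsetSym K a ∅ = 1 := rfl

/-- Expansion of the symmetrized product along its first factor. -/
theorem symProd_succ {n : ℕ} (a : Fin (n + 1) → A) :
    symProd K a = ((n + 1 : ℕ) : K)⁻¹ •
      ∑ p, a p * symProd K (fun x : Fin n => a (Equiv.swap 0 p x.succ)) := by
  -- `Equiv.Perm.decomposeFin` splits a permutation into its value p at 0 and a permutation of the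
  -- remaining positions.
  have h : ∀ p, a p * symProd K (fun x : Fin n => a (Equiv.swap 0 p x.succ)) =
      ((Nat.factorial n : K)⁻¹) • ∑ e : Equiv.Perm (Fin n),
        (List.ofFn fun r => a (Equiv.Perm.decomposeFin.symm (p, e) r)).prod := by
    intro p
    rw [symProd, mul_smul_comm, Finset.mul_sum]
    simp [List.ofFn_succ]
  simp_rw [h]
  rw [← Finset.smul_sum, smul_smul, symProd, Nat.factorial_succ, Nat.cast_mul, mul_inv,
    ← Equiv.sum_comp Equiv.Perm.decomposeFin.symm, Fintype.sum_prod_type]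

variable [CharZero K]

theorem card_smul_finsetSym (a : ι → A) (s : Finset ι) :
    (s.card : K) • finsetSym K a s = ∑ i ∈ s, a i * finsetSym K a (s.erase i) := by
  rcases s.eq_empty_or_nonempty with rfl | hs
  · simp
  obtain ⟨n, hn⟩ : ∃ n, s.card = n + 1 := ⟨s.card - 1, by have := hs.card_pos; omega⟩
  have h0 : ((n + 1 : ℕ) : K) ≠ 0 := Nat.cast_ne_zero.2 n.succ_ne_zero
  rw [finsetSym, hn, symAux, smul_inv_smul₀ h0]
  refine Finset.sum_congr rfl fun i hi => ?_
  rw [finsetSym, Finset.card_erase_of_mem hi, hn, Nat.add_sub_cancel]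

/-- Both sides obey the same first-factor recursion: after p is split off, the swap of 0 and p
carries the successors onto all indices except p. Hence the order of the tuple is irrelevant. -/
theorem symProd_comp_embedding (a : ι → A) {n : ℕ} (f : Fin n ↪ ι) :
    symProd K (fun r => a (f r)) = finsetSym K a (Finset.univ.map f) := by
  induction n with
  | zero => simp [symProd, finsetSym_empty]
  | succ n ih =>
    have h0 : ((n + 1 : ℕ) : K) ≠ 0 := Nat.cast_ne_zero.2 n.succ_ne_zero
    have hrec := card_smul_finsetSym (K := K) a (Finset.univ.map f)
    rw [Finset.card_map, Finset.card_fin, Finset.sum_map] at hrec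
    rw [symProd_succ, inv_smul_eq_iff₀ h0, hrec]
    refine Finset.sum_congr rfl fun p _ => ?_
    have := ih (((Fin.succEmb n).trans (Equiv.swap 0 p).toEmbedding).trans f)
    simp only [Function.Embedding.trans_apply] at this
    refine congrArg (a (f p) * ·) (this.trans (congrArg _ ?_))
    ext x
    simp only [Finset.mem_map, Finset.mem_univ, true_and, Finset.mem_erase]
    constructor
    · rintro ⟨y, rfl⟩
      refine ⟨fun h => ?_, _, rfl⟩
      have h' := f.injective h
      simp only [Function.Embedding.trans_apply, Equiv.coe_toEmbedding] at h'
      rw [Equiv.swap_apply_eq_iff, Equiv.swap_apply_right] at h'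
      exact Fin.succ_ne_zero y h'
    · rintro ⟨hx, y, rfl⟩
      have hy : Equiv.swap 0 p y ≠ 0 := by
        rw [Ne, Equiv.swap_apply_eq_iff, Equiv.swap_apply_left]
        exact fun h => hx (h ▸ rfl)
      obtain ⟨z, hz⟩ := Fin.exists_succ_eq.2 hy
      refine ⟨z, congrArg f ?_⟩
      change Equiv.swap 0 p z.succ = y
      rw [hz, Equiv.swap_apply_self]

/-- The commutator with an element whose commutators with the factors are scalars. -/
theorem finsetSym_mul_of_lie (a : ι → A) (b : A) (c : ι → K)
    (h : ∀ i, ⁅a i, b⁆ = algebraMap K A (c i)) (s : Finset ι) :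
    finsetSym K a s * b = b * finsetSym K a s + ∑ i ∈ s, c i • finsetSym K a (s.erase i) := by
  induction s using Finset.strongInduction with
  | H s ih =>
  rcases s.eq_empty_or_nonempty with rfl | hs
  · simp [finsetSym_empty]
  have h0 : (s.card : K) ≠ 0 := Nat.cast_ne_zero.2 hs.card_pos.ne'
  refine smul_right_injective A h0 ?_
  change (s.card : K) • _ = (s.card : K) • _
  rw [smul_add, ← smul_mul_assoc, ← mul_smul_comm, card_smul_finsetSym a s, Finset.sum_mul,
    Finset.mul_sum, Finset.smul_sum]
  have hab : ∀ i, a i * b = b * a i + algebraMap K A (c i) := fun i => by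
    rw [← h i, Ring.lie_def]; abel
  -- Moving b past the first factor gives one correction term, moving it past the rest gives the
  -- others by induction.
  have h1 : ∀ i ∈ s, a i * finsetSym K a (s.erase i) * b =
      b * (a i * finsetSym K a (s.erase i)) + c i • finsetSym K a (s.erase i) +
        ∑ k ∈ s.erase i, c k • (a i * finsetSym K a ((s.erase k).erase i)) := by
    intro i hi
    rw [mul_assoc, ih _ (Finset.erase_ssubset hi), mul_add, ← mul_assoc, hab, add_mul,
      ← Algebra.smul_def, Finset.mul_sum, mul_assoc]
    congr 1
    refine Finset.sum_congr rfl fun k _ => ?_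
    rw [mul_smul_comm, Finset.erase_right_comm]
  -- Split |s| = 1 + (|s| - 1) and expand the second share along its first factor; this matches the
  -- corrections in `h1` after exchanging the sums.
  have h2 : ∀ k ∈ s, (s.card : K) • c k • finsetSym K a (s.erase k) =
      c k • finsetSym K a (s.erase k) +
        ∑ i ∈ s.erase k, c k • (a i * finsetSym K a ((s.erase k).erase i)) := by
    intro k hk
    rw [← Finset.smul_sum, ← card_smul_finsetSym a (s.erase k), ← smul_add, smul_comm]
    congr 1
    rw [← Finset.card_erase_add_one hk]
    push_cast
    rw [add_smul, one_smul, add_comm]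
  rw [Finset.sum_congr rfl h1, Finset.sum_congr rfl h2]
  simp only [Finset.sum_add_distrib]
  rw [add_assoc]
  congr 2
  refine Finset.sum_comm' fun x y => ?_
  simp only [Finset.mem_erase]
  tauto

end SymmetrizedProduct

/-! ### Partial matchings -/

section Matchings

variable {α β : Type*} [DecidableEq α] [DecidableEq β]

open Classical in
/-- The partial matchings between `s` and `t`: sets of pairs in which no element of `s` and no
element of `t` occurs twice. -/
noncomputable def matchings (s : Finset α) (t : Finset β) : Finset (Finset (α × β)) :=
  (s ×ˢ t).powerset.filter fun p =>
    Set.InjOn Prod.fst (p : Set (α × β)) ∧ Set.InjOn Prod.snd (p : Set (α × β))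

theorem mem_matchings {s : Finset α} {t : Finset β} {p : Finset (α × β)} :
    p ∈ matchings s t ↔ (∀ x ∈ p, x.1 ∈ s ∧ x.2 ∈ t) ∧
      (∀ x ∈ p, ∀ y ∈ p, x.1 = y.1 → x = y) ∧ ∀ x ∈ p, ∀ y ∈ p, x.2 = y.2 → x = y := by
  simp only [matchings, Finset.mem_filter, Finset.mem_powerset, Finset.subset_iff,
    Finset.mem_product, Set.InjOn, Finset.mem_coe]

theorem card_image_fst_of_mem_matchings {s : Finset α} {t : Finset β} {p : Finset (α × β)}
    (hp : p ∈ matchings s t) : (p.image Prod.fst).card = p.card :=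
  Finset.card_image_of_injOn fun x hx y hy => (mem_matchings.1 hp).2.1 x hx y hy

theorem card_image_snd_of_mem_matchings {s : Finset α} {t : Finset β} {p : Finset (α × β)}
    (hp : p ∈ matchings s t) : (p.image Prod.snd).card = p.card :=
  Finset.card_image_of_injOn fun x hx y hy => (mem_matchings.1 hp).2.2 x hx y hy

theorem image_fst_subset_of_mem_matchings {s : Finset α} {t : Finset β} {p : Finset (α × β)}
    (hp : p ∈ matchings s t) : p.image Prod.fst ⊆ s :=
  Finset.image_subset_iff.2 fun x hx => ((mem_matchings.1 hp).1 x hx).1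

theorem image_snd_subset_of_mem_matchings {s : Finset α} {t : Finset β} {p : Finset (α × β)}
    (hp : p ∈ matchings s t) : p.image Prod.snd ⊆ t :=
  Finset.image_subset_iff.2 fun x hx => ((mem_matchings.1 hp).1 x hx).2

theorem mem_matchings_erase_left {s : Finset α} {t : Finset β} {p : Finset (α × β)} {i : α} :
    p ∈ matchings (s.erase i) t ↔ p ∈ matchings s t ∧ i ∉ p.image Prod.fst := by
  simp only [mem_matchings, Finset.mem_erase, Finset.mem_image]
  grind

theorem mem_matchings_erase_right {s : Finset α} {t : Finset β} {p : Finset (α × β)} {j : β} :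
    p ∈ matchings s (t.erase j) ↔ p ∈ matchings s t ∧ j ∉ p.image Prod.snd := by
  simp only [mem_matchings, Finset.mem_erase, Finset.mem_image]
  grind

/-- The unmatched elements of `s` and of `t`. -/
def unmatched (s : Finset α) (t : Finset β) (p : Finset (α × β)) : Finset (α ⊕ β) :=
  (s \ p.image Prod.fst).disjSum (t \ p.image Prod.snd)

theorem card_unmatched {s : Finset α} {t : Finset β} {p : Finset (α × β)}
    (hp : p ∈ matchings s t) : (unmatched s t p).card + 2 * p.card = s.card + t.card := by
  have h1 := Finset.card_sdiff_add_card_eq_card (image_fst_subset_of_mem_matchings hp)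
  have h2 := Finset.card_sdiff_add_card_eq_card (image_snd_subset_of_mem_matchings hp)
  rw [card_image_fst_of_mem_matchings hp] at h1
  rw [card_image_snd_of_mem_matchings hp] at h2
  rw [unmatched, Finset.card_disjSum]
  omega

theorem unmatched_erase_inl (s : Finset α) (t : Finset β) (p : Finset (α × β)) (i : α) :
    (unmatched s t p).erase (Sum.inl i) = unmatched (s.erase i) t p := by
  ext (x | x) <;> simp [unmatched, and_assoc]

theorem unmatched_erase_inr (s : Finset α) (t : Finset β) (p : Finset (α × β)) (j : β) :
    (unmatched s t p).erase (Sum.inr j) = unmatched s (t.erase j) p := by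
  ext (x | x) <;> simp [unmatched, and_assoc]

theorem unmatched_insert (s : Finset α) (t : Finset β) (p : Finset (α × β)) (x : α × β) :
    unmatched s t (insert x p) = unmatched (s.erase x.1) (t.erase x.2) p := by
  ext (y | y) <;> simp [unmatched] <;> grind

/-- Summing over the pairs of a matching amounts to choosing a pair and matching the rest. -/
theorem sum_matchings_sum_mem {N : Type*} [AddCommMonoid N] (s : Finset α) (t : Finset β)
    (g : α × β → Finset (α × β) → N) :
    ∑ p ∈ matchings s t, ∑ x ∈ p, g x (p.erase x) =
      ∑ x ∈ s ×ˢ t, ∑ q ∈ matchings (s.erase x.1) (t.erase x.2), g x q := by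
  rw [Finset.sum_sigma', Finset.sum_sigma']
  refine Finset.sum_bij' (fun y _ => ⟨y.2, y.1.erase y.2⟩) (fun y _ => ⟨insert y.1 y.2, y.1⟩)
    ?_ ?_ ?_ ?_ ?_
  · rintro ⟨p, x⟩ h
    simp only [Finset.mem_sigma, mem_matchings, Finset.mem_erase, Finset.mem_product] at h ⊢
    grind
  · rintro ⟨x, q⟩ h
    simp only [Finset.mem_sigma, mem_matchings, Finset.mem_erase, Finset.mem_product,
      Finset.mem_insert] at h ⊢
    grind
  · rintro ⟨p, x⟩ h
    simp only [Finset.mem_sigma] at h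
    simp [Finset.insert_erase h.2]
  · rintro ⟨x, q⟩ h
    simp only [Finset.mem_sigma, mem_matchings, Finset.mem_erase] at h
    have hx : x ∉ q := fun hx => (h.2.1 x hx).1.1 rfl
    simp [Finset.erase_insert hx]
  · rintro ⟨p, x⟩ h
    rfl

end Matchings

/-! ### The common recursion and the product formula -/

section Product

variable {K A α β : Type*} [Field K] [Ring A] [Algebra K A] [DecidableEq α]
  [DecidableEq β]

/-- The sum over all contractions of `L i`, `i ∈ s`, with `M j`, `j ∈ t`. -/
noncomputable def contractionSum (L : α → A) (M : β → A) (d : α → β → K) (s : Finset α)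
    (t : Finset β) : A :=
  ∑ p ∈ matchings s t, ((1 / 2 ^ p.card : K) * ∏ x ∈ p, d x.1 x.2) •
    finsetSym K (Sum.elim L M) (unmatched s t p)

theorem contractionSum_empty (L : α → A) (M : β → A) (d : α → β → K) :
    contractionSum L M d ∅ ∅ = 1 := by
  have h : matchings (∅ : Finset α) (∅ : Finset β) = {∅} := by
    ext p
    simp only [mem_matchings, Finset.notMem_empty, Finset.mem_singleton,
      Finset.eq_empty_iff_forall_notMem]
    grind
  simp [contractionSum, h, unmatched, finsetSym_empty]

variable [CharZero K]

/-- For each matching p, |s| + |t| is the number of unmatched elements plus 2|p|. The first share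
expands the symmetrized product along its first factor; the second removes one pair from p. -/
theorem card_smul_contractionSum (L : α → A) (M : β → A) (d : α → β → K) (s : Finset α)
    (t : Finset β) :
    ((s.card + t.card : ℕ) : K) • contractionSum L M d s t =
      ∑ i ∈ s, L i * contractionSum L M d (s.erase i) t +
      ∑ j ∈ t, M j * contractionSum L M d s (t.erase j) +
      ∑ x ∈ s ×ˢ t, d x.1 x.2 • contractionSum L M d (s.erase x.1) (t.erase x.2) := by
  set w : Finset (α × β) → K := fun p => (1 / 2 ^ p.card : K) * ∏ x ∈ p, d x.1 x.2 with hw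
  set S : Finset (α ⊕ β) → A := finsetSym K (Sum.elim L M) with hS
  have hp : ∀ p ∈ matchings s t, ((s.card + t.card : ℕ) : K) • w p • S (unmatched s t p) =
      ∑ i ∈ s \ p.image Prod.fst, L i * w p • S (unmatched (s.erase i) t p) +
      ∑ j ∈ t \ p.image Prod.snd, M j * w p • S (unmatched s (t.erase j) p) +
      ∑ x ∈ p, d x.1 x.2 • w (p.erase x) •
        S (unmatched (s.erase x.1) (t.erase x.2) (p.erase x)) := by
    intro p hp
    have h1 : ((unmatched s t p).card : K) • S (unmatched s t p) =
        ∑ i ∈ s \ p.image Prod.fst, L i * S (unmatched (s.erase i) t p) +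
        ∑ j ∈ t \ p.image Prod.snd, M j * S (unmatched s (t.erase j) p) := by
      rw [hS, card_smul_finsetSym, unmatched, Finset.sum_disjSum, ← unmatched]
      simp only [Sum.elim_inl, Sum.elim_inr, unmatched_erase_inl, unmatched_erase_inr]
    -- Removing a pair x drops a factor d/2 from the weight; this is where the powers of 1/2 are
    -- needed.
    have h2 : ∀ x ∈ p, d x.1 x.2 • w (p.erase x) •
        S (unmatched (s.erase x.1) (t.erase x.2) (p.erase x)) =
          (2 * w p) • S (unmatched s t p) := by
      intro x hx
      rw [← unmatched_insert, Finset.insert_erase hx, smul_smul]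
      congr 1
      simp only [hw]
      rw [← Finset.mul_prod_erase p _ hx, ← Finset.card_erase_add_one hx, pow_succ]
      field_simp
    rw [Finset.sum_congr rfl h2, Finset.sum_const, ← card_unmatched hp]
    simp only [mul_smul_comm]
    rw [← Finset.smul_sum, ← Finset.smul_sum, ← smul_add, ← h1, ← Nat.cast_smul_eq_nsmul K]
    push_cast
    simp only [smul_smul, ← add_smul]
    congr 1
    ring
  simp only [contractionSum]
  rw [Finset.smul_sum, Finset.sum_congr rfl hp, Finset.sum_add_distrib, Finset.sum_add_distrib,
    sum_matchings_sum_mem s t fun x q => d x.1 x.2 • w q •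
      S (unmatched (s.erase x.1) (t.erase x.2) q)]
  simp only [Finset.mul_sum, Finset.smul_sum]
  congr 2
  -- A matching that leaves i unmatched is a matching of s \ i with t.
  · refine Finset.sum_comm' fun p i => ?_
    rw [mem_matchings_erase_left, Finset.mem_sdiff]
    tauto
  · refine Finset.sum_comm' fun p j => ?_
    rw [mem_matchings_erase_right, Finset.mem_sdiff]
    tauto

/-- The share |s| expands the left product, the share |t| the right one. In the latter the split-off
M_j must pass the symmetrized product of the L_i, which produces the terms with d_ij. -/
theorem card_smul_finsetSym_mul_finsetSym (L : α → A) (M : β → A) (d : α → β → K)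
    (hLM : ∀ i j, ⁅L i, M j⁆ = algebraMap K A (d i j)) (s : Finset α) (t : Finset β) :
    ((s.card + t.card : ℕ) : K) • (finsetSym K L s * finsetSym K M t) =
      ∑ i ∈ s, L i * (finsetSym K L (s.erase i) * finsetSym K M t) +
      ∑ j ∈ t, M j * (finsetSym K L s * finsetSym K M (t.erase j)) +
      ∑ x ∈ s ×ˢ t, d x.1 x.2 •
        (finsetSym K L (s.erase x.1) * finsetSym K M (t.erase x.2)) := by
  rw [Nat.cast_add, add_smul, ← smul_mul_assoc, ← mul_smul_comm,
    card_smul_finsetSym L s,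
    card_smul_finsetSym M t, Finset.sum_mul,
    Finset.mul_sum, Finset.sum_product_right, add_assoc, ← Finset.sum_add_distrib]
  congr 1
  · simp only [mul_assoc]
  · refine Finset.sum_congr rfl fun j _ => ?_
    rw [← mul_assoc, finsetSym_mul_of_lie L (M j) (fun i => d i j) (fun i => hLM i j), add_mul,
      Finset.sum_mul, mul_assoc]
    simp only [smul_mul_assoc]

theorem finsetSym_mul_finsetSym (L : α → A) (M : β → A) (d : α → β → K)
    (hLM : ∀ i j, ⁅L i, M j⁆ = algebraMap K A (d i j)) (s : Finset α) (t : Finset β) :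
    finsetSym K L s * finsetSym K M t = contractionSum L M d s t := by
  induction hn : s.card + t.card using Nat.strong_induction_on generalizing s t with
  | _ n ih =>
  subst hn
  rcases Nat.eq_zero_or_pos (s.card + t.card) with h | h
  · obtain ⟨hs, ht⟩ := Nat.add_eq_zero_iff.1 h
    rw [Finset.card_eq_zero] at hs ht
    rw [hs, ht, contractionSum_empty, finsetSym_empty, finsetSym_empty, one_mul]
  have h0 : ((s.card + t.card : ℕ) : K) ≠ 0 := Nat.cast_ne_zero.2 h.ne'
  refine smul_right_injective A h0 ?_
  change ((s.card + t.card : ℕ) : K) • _ = ((s.card + t.card : ℕ) : K) • _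
  rw [card_smul_contractionSum, card_smul_finsetSym_mul_finsetSym L M d hLM]
  congr 1
  · congr 1
    · refine Finset.sum_congr rfl fun i hi => ?_
      have := Finset.card_erase_lt_of_mem hi
      rw [ih _ (by omega) _ _ rfl]
    · refine Finset.sum_congr rfl fun j hj => ?_
      have := Finset.card_erase_lt_of_mem hj
      rw [ih _ (by omega) _ _ rfl]
  · refine Finset.sum_congr rfl fun x hx => ?_
    rw [Finset.mem_product] at hx
    have h1 := Finset.card_erase_lt_of_mem hx.1
    have h2 := Finset.card_erase_lt_of_mem hx.2
    rw [ih _ (by omega) _ _ rfl]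

end Product

/-! ### Matchings of size h as triples (I, J, π) -/

namespace Parts

variable {h l m : ℕ}

theorem enum_mem (I : Parts h m) (r : Fin h) : I.enum r ∈ I.1 :=
  Finset.orderEmbOfFin_mem _ _ _

theorem exists_enum_eq (I : Parts h m) {i : Fin m} (hi : i ∈ I.1) : ∃ r, I.enum r = i := by
  have : i ∈ Set.range (I.1.orderEmbOfFin I.2) := by rwa [Finset.range_orderEmbOfFin]
  exact this

theorem exists_enumCompl_eq_iff (I : Parts h m) {i : Fin m} :
    (∃ r, I.enumCompl r = i) ↔ i ∉ I.1 := by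
  change i ∈ Set.range ((I.1)ᶜ.orderEmbOfFin I.card_compl) ↔ _
  rw [Finset.range_orderEmbOfFin]
  simp

/-- The matching of `I` with `J` that is given by a permutation. -/
def matching (I : Parts h l) (J : Parts h m) (π : Equiv.Perm (Fin h)) :
    Finset (Fin l × Fin m) :=
  Finset.univ.map ⟨fun r => (I.enum r, J.enum (π r)),
    fun _ _ e => I.enum.injective (Prod.ext_iff.1 e).1⟩

theorem mem_matching {I : Parts h l} {J : Parts h m} {π : Equiv.Perm (Fin h)}
    {x : Fin l × Fin m} : x ∈ matching I J π ↔ ∃ r, (I.enum r, J.enum (π r)) = x := by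
  simp only [matching, Finset.mem_map, Finset.mem_univ, true_and]
  rfl

theorem image_fst_matching (I : Parts h l) (J : Parts h m) (π : Equiv.Perm (Fin h)) :
    (matching I J π).image Prod.fst = I.1 := by
  ext i
  simp only [Finset.mem_image, mem_matching]
  constructor
  · rintro ⟨_, ⟨r, rfl⟩, rfl⟩
    exact I.enum_mem r
  · intro hi
    obtain ⟨r, rfl⟩ := I.exists_enum_eq hi
    exact ⟨_, ⟨r, rfl⟩, rfl⟩

theorem image_snd_matching (I : Parts h l) (J : Parts h m) (π : Equiv.Perm (Fin h)) :
    (matching I J π).image Prod.snd = J.1 := by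
  ext j
  simp only [Finset.mem_image, mem_matching]
  constructor
  · rintro ⟨_, ⟨r, rfl⟩, rfl⟩
    exact J.enum_mem _
  · intro hj
    obtain ⟨r, rfl⟩ := J.exists_enum_eq hj
    exact ⟨_, ⟨π.symm r, rfl⟩, by simp⟩

theorem card_matching (I : Parts h l) (J : Parts h m) (π : Equiv.Perm (Fin h)) :
    (matching I J π).card = h := by
  simp [matching]

theorem matching_mem_matchings (I : Parts h l) (J : Parts h m) (π : Equiv.Perm (Fin h)) :
    matching I J π ∈ matchings Finset.univ Finset.univ := by
  rw [mem_matchings]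
  refine ⟨fun _ _ => by simp, ?_, ?_⟩
  · intro x hx y hy e
    obtain ⟨r, rfl⟩ := mem_matching.1 hx
    obtain ⟨r', rfl⟩ := mem_matching.1 hy
    rw [I.enum.injective e]
  · intro x hx y hy e
    obtain ⟨r, rfl⟩ := mem_matching.1 hx
    obtain ⟨r', rfl⟩ := mem_matching.1 hy
    rw [π.injective (J.enum.injective e)]

theorem matching_injective {I I' : Parts h l} {J J' : Parts h m} {π π' : Equiv.Perm (Fin h)}
    (e : matching I J π = matching I' J' π') : I = I' ∧ J = J' ∧ π = π' := by
  have hI : I = I' := Subtype.ext <| by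
    rw [← image_fst_matching I J π, e, image_fst_matching]
  have hJ : J = J' := Subtype.ext <| by
    rw [← image_snd_matching I J π, e, image_snd_matching]
  subst hI hJ
  refine ⟨rfl, rfl, Equiv.ext fun r => ?_⟩
  have hr : (I.enum r, J.enum (π r)) ∈ matching I J π' := e ▸ mem_matching.2 ⟨r, rfl⟩
  obtain ⟨r', hr'⟩ := mem_matching.1 hr
  obtain ⟨h1, h2⟩ := Prod.ext_iff.1 hr'
  have h1 : r' = r := I.enum.injective h1
  have h2 : π' r' = π r := J.enum.injective h2
  rw [← h2, h1]

theorem exists_matching_eq {p : Finset (Fin l × Fin m)}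
    (hp : p ∈ matchings Finset.univ Finset.univ) (hc : p.card = h) :
    ∃ (I : Parts h l) (J : Parts h m) (π : Equiv.Perm (Fin h)), matching I J π = p := by
  let I : Parts h l := ⟨p.image Prod.fst, (card_image_fst_of_mem_matchings hp).trans hc⟩
  let J : Parts h m := ⟨p.image Prod.snd, (card_image_snd_of_mem_matchings hp).trans hc⟩
  have hf : ∀ r, ∃ r', (I.enum r, J.enum r') ∈ p := by
    intro r
    obtain ⟨x, hx, e⟩ := Finset.mem_image.1 (I.enum_mem r)
    obtain ⟨r', hr'⟩ := J.exists_enum_eq (Finset.mem_image_of_mem Prod.snd hx)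
    exact ⟨r', by rw [hr', ← e]; exact hx⟩
  choose f hf using hf
  have hinj : Function.Injective f := fun r r' e => by
    have := (mem_matchings.1 hp).2.2 _ (hf r) _ (hf r') (congrArg J.enum e)
    exact I.enum.injective (Prod.ext_iff.1 this).1
  let π : Equiv.Perm (Fin h) := Equiv.ofBijective f (Finite.injective_iff_bijective.1 hinj)
  -- One inclusion suffices, since both matchings have h pairs.
  refine ⟨I, J, π, Finset.eq_of_subset_of_card_le (fun x hx => ?_) ?_⟩
  · obtain ⟨r, rfl⟩ := mem_matching.1 hx
    exact hf r
  · rw [card_matching, hc]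

theorem sum_matchings_card_eq {N : Type*} [AddCommMonoid N] (g : Finset (Fin l × Fin m) → N) :
    ∑ p ∈ matchings (Finset.univ : Finset (Fin l)) (Finset.univ : Finset (Fin m)) with p.card = h,
        g p =
      ∑ I : Parts h l, ∑ J : Parts h m, ∑ π : Equiv.Perm (Fin h), g (matching I J π) := by
  simp_rw [← Fintype.sum_prod_type']
  symm
  refine Finset.sum_bij (fun y _ => matching y.1 y.2.1 y.2.2) ?_ ?_ ?_ ?_
  · intro y _
    exact Finset.mem_filter.2 ⟨matching_mem_matchings _ _ _, card_matching _ _ _⟩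
  · rintro ⟨I, J, π⟩ _ ⟨I', J', π'⟩ _ e
    obtain ⟨rfl, rfl, rfl⟩ := matching_injective e
    rfl
  · intro p hp
    obtain ⟨hp, hc⟩ := Finset.mem_filter.1 hp
    obtain ⟨I, J, π, e⟩ := exists_matching_eq hp hc
    exact ⟨⟨I, J, π⟩, Finset.mem_univ _, e⟩
  · intro _ _
    rfl

/-- The unmatched elements depend only on I and J, so any π serves here. -/
theorem symProd_append_enumCompl {K A : Type*} [Field K] [CharZero K] [Ring A] [Algebra K A]
    (L : Fin l → A) (M : Fin m → A) (I : Parts h l) (J : Parts h m) (π : Equiv.Perm (Fin h)) :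
    symProd K (Fin.append (fun s : Fin (l - h) => L (I.enumCompl s))
        (fun t : Fin (m - h) => M (J.enumCompl t))) =
      finsetSym K (Sum.elim L M) (unmatched Finset.univ Finset.univ (matching I J π)) := by
  let f : Fin (l - h + (m - h)) ↪ Fin l ⊕ Fin m :=
    finSumFinEquiv.symm.toEmbedding.trans
      (Function.Embedding.sumMap I.enumCompl.toEmbedding J.enumCompl.toEmbedding)
  have hf : Fin.append (fun s : Fin (l - h) => L (I.enumCompl s))
      (fun t : Fin (m - h) => M (J.enumCompl t)) = fun r => Sum.elim L M (f r) := by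
    funext r
    refine Fin.addCases (fun i => ?_) (fun i => ?_) r <;> simp [f]
  rw [hf, symProd_comp_embedding]
  congr 1
  have hr : Finset.univ.map f = (Finset.univ.map I.enumCompl.toEmbedding).disjSum
      (Finset.univ.map J.enumCompl.toEmbedding) := by
    rw [← Finset.map_map, Finset.map_univ_equiv]
    ext (x | x) <;> simp
  rw [hr, unmatched, image_fst_matching, image_snd_matching]
  congr 1 <;> ext x <;> simp [exists_enumCompl_eq_iff]

end Parts

theorem mainTheorem8 {K A : Type*} [Field K] [CharZero K] [Ring A] [Algebra K A]
    (l m : ℕ) (L : Fin l → A) (M : Fin m → A) (d : Fin l → Fin m → K)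
    (hLM : ∀ (i : Fin l) (j : Fin m), ⁅L i, M j⁆ = algebraMap K A (d i j)) :
    symProd K L * symProd K M =
      ∑ h ∈ Finset.range (min l m + 1), ∑ I : Parts h l, ∑ J : Parts h m,
        ∑ π : Equiv.Perm (Fin h),
          ((1 / 2 ^ h : K) * ∏ r : Fin h, d (I.enum r) (J.enum (π r))) •
            symProd K (Fin.append (fun s : Fin (l - h) => L (I.enumCompl s))
              (fun t : Fin (m - h) => M (J.enumCompl t))) := by
  have hL := symProd_comp_embedding (K := K) L (Function.Embedding.refl _)
  have hM := symProd_comp_embedding (K := K) M (Function.Embedding.refl _)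
  simp only [Function.Embedding.refl_apply, Finset.map_refl] at hL hM
  have hcard : ∀ p ∈ matchings (Finset.univ : Finset (Fin l)) (Finset.univ : Finset (Fin m)),
      p.card ∈ Finset.range (min l m + 1) := by
    intro p hp
    have h1 := Finset.card_le_univ (p.image Prod.fst)
    have h2 := Finset.card_le_univ (p.image Prod.snd)
    rw [card_image_fst_of_mem_matchings hp, Fintype.card_fin] at h1
    rw [card_image_snd_of_mem_matchings hp, Fintype.card_fin] at h2
    exact Finset.mem_range.2 (Nat.lt_succ_of_le (le_min h1 h2))
  rw [hL, hM, finsetSym_mul_finsetSym L M d hLM, contractionSum,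
    ← Finset.sum_fiberwise_of_maps_to hcard]
  refine Finset.sum_congr rfl fun h _ => ?_
  rw [Parts.sum_matchings_card_eq]
  refine Finset.sum_congr rfl fun I _ => Finset.sum_congr rfl fun J _ =>
    Finset.sum_congr rfl fun π _ => ?_
  rw [Parts.symProd_append_enumCompl L M I J π, Parts.card_matching, Parts.matching,
    Finset.prod_map]
  rfl
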